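/- Two cakes, each of length $1$, are each to be cut into $2$ pieces. A division is a matrix $x=(x_{ij})_{1\le i,j\le 2}$ with $x_{ij}\ge 0$ and $x_{i1}+x_{i2}=1$ for each $i$, where $x_{ij}$ is the length of the $j$-th piece of the $i$-th cake. A piece selection is a choice of one piece from each cake; two piece selections are disjoint if they have no common piece on either cake. There are three players. For each player and each division there is a strict partial order ``better than'' on the four piece selections (preferences may be linked over the two cakes), depending only on that player and the division and not on the choices of the other players. A player prefers a piece selection $s$ in a division $x$ (that is, $s$ is an envy-free piece selection for that player in $x$) if, in $x$, the player does not think that any other piece selection is better than $s$. Assume that every player satisfies: (i) (hungry) in every division, if two piece selections differ at most in the piece selected from one cake, and that piece is empty in the first and nonempty in the second, then the second piece selection is better than the first; (ii) (closed preference sets) if $x^{(n)}\to x$ is a convergent sequence of divisions and the player prefers the piece selection $s$ in every $x^{(n)}$, then the player prefers $s$ in $x$. Then there exist a division $x$, two different players $p\ne q$, and disjoint piece selections $s,t$ such that $p$ prefers $s$ in $x$ and $q$ prefers $t$ in $x$. -/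

import Mathlib

open Filter Topology

/-- The polytope of divisions of `m` cakes of length `1` into `k` pieces each: the entry `x i j` is
the length of the `j`-th piece of the `i`-th cake, so all entries are nonnegative and every row
sums to `1`. -/
def Division (m k : ℕ) : Type :=
  {x : Fin m → Fin k → ℝ // ∀ i, (∀ j, 0 ≤ x i j) ∧ ∑ j, x i j = 1}

/-- The topology of the space of matrices. -/
instance (m k : ℕ) : TopologicalSpace (Division m k) :=
  inferInstanceAs (TopologicalSpace
    {x : Fin m → Fin k → ℝ // ∀ i, (∀ j, 0 ≤ x i j) ∧ ∑ j, x i j = 1})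

/-- A piece selection: a choice of one piece from each cake. -/
abbrev PieceSelection (m k : ℕ) : Type := Fin m → Fin k

/-- Two piece selections are disjoint if they have no common piece on any cake. -/
def DisjointSelections {m k : ℕ} (s t : PieceSelection m k) : Prop := ∀ i, s i ≠ t i

/-- The preferences of a single player: `better x t s` says that, in the division `x`, the player
thinks that the piece selection `t` is (strictly) better than the piece selection `s`.
The preferences may be linked over the cakes. They depend on the division and on the player only,
not on the choices made by other players. -/
abbrev Preference (m k : ℕ) : Type :=
  Division m k → PieceSelection m k → PieceSelection m k → Prop

/-- In the division `x` the player prefers `s`: no other piece selection is thought to be better.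
Such an `s` is an envy-free piece selection for the player. -/
def Prefers {m k : ℕ} (better : Preference m k) (x : Division m k) (s : PieceSelection m k) :
    Prop :=
  ∀ t, t ≠ s → ¬ better x t s

/-- In each division, "better" is a strict partial order on the piece selections. -/
def IsOrderly {m k : ℕ} (better : Preference m k) : Prop :=
  ∀ x, (∀ s, ¬ better x s s) ∧ ∀ r s t, better x r s → better x s t → better x r t

/-- The player is hungry: a nonempty piece of a cake is better than an empty piece of that cake,
the pieces selected in the other cakes being fixed. -/
def IsHungry {m k : ℕ} (better : Preference m k) : Prop :=
  ∀ (x : Division m k) (s t : PieceSelection m k) (i : Fin m),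
    (∀ j, j ≠ i → t j = s j) → x.1 i (s i) = 0 → 0 < x.1 i (t i) → better x t s

/-- Preference sets are closed: a piece selection that is preferred for each term of a convergent
sequence of divisions is preferred in the limiting division. -/
def HasClosedPreferenceSets {m k : ℕ} (better : Preference m k) : Prop :=
  ∀ (s : PieceSelection m k) (u : ℕ → Division m k) (x : Division m k),
    Tendsto u atTop (𝓝 x) → (∀ n, Prefers better (u n) s) → Prefers better x s

/-!
Identify a division with the point of the unit square whose coordinates are the lengths of the first
pieces, triangulate the square finely, colour the vertices by the three players so that neighbours
get different colours, and label every vertex by a piece selection its player prefers. Joined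
whenever they are not disjoint, the four piece selections form a 4-cycle. If no edge of the
triangulation had disjoint labels, the labelling would map the boundary of the square to a
null-homotopic walk on this cycle; but hungry players never choose an empty piece, which forces the
boundary walk to wind around the cycle once. Hence some arbitrarily close divisions carry disjoint
selections preferred by different players, and compactness turns them into a single division.
-/

/-- The signed number of passages from `(1, 1)` to `(1, 0)` made by a step between two piece
selections. Summed along a closed walk on the 4-cycle of piece selections, it is the winding
number of the walk. -/
def crossing (s t : PieceSelection 2 2) : ℤ :=
  if s 0 = 1 ∧ t 0 = 1 then ((s 1 : ℕ) : ℤ) - ((t 1 : ℕ) : ℤ) else 0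

theorem crossing_self (s : PieceSelection 2 2) : crossing s s = 0 := by
  simp [crossing]

theorem neg_crossing (s t : PieceSelection 2 2) : -crossing s t = crossing t s := by
  simp only [crossing, and_comm (a := s 0 = 1), neg_ite, neg_sub, neg_zero]

-- A 4-cycle contains no triangle.
theorem eq_or_eq_or_eq_of_not_disjointSelections {s t u : PieceSelection 2 2}
    (hst : ¬ DisjointSelections s t) (htu : ¬ DisjointSelections t u)
    (hsu : ¬ DisjointSelections s u) : s = t ∨ t = u ∨ s = u := by
  unfold DisjointSelections at *
  revert s t u
  decide

theorem crossing_add_crossing {s t u : PieceSelection 2 2} (hst : ¬ DisjointSelections s t)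
    (htu : ¬ DisjointSelections t u) (hsu : ¬ DisjointSelections s u) :
    crossing s t + crossing t u = crossing s u := by
  rcases eq_or_eq_or_eq_of_not_disjointSelections hst htu hsu with rfl | rfl | rfl
  · rw [crossing_self, zero_add]
  · rw [crossing_self, add_zero]
  · rw [← neg_crossing s t, crossing_self, add_neg_cancel]

section Walk

open Finset

variable {N : ℕ} {l : ℕ → PieceSelection 2 2}

theorem sum_crossing_of_fst_eq_one (h : ∀ j ≤ N, l j 0 = 1) :
    ∑ j ∈ range N, crossing (l j) (l (j + 1)) = ((l 0 1 : ℕ) : ℤ) - ((l N 1 : ℕ) : ℤ) := by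
  rw [← sum_range_sub' fun j => ((l j 1 : ℕ) : ℤ)]
  refine sum_congr rfl fun j hj => if_pos ?_
  exact ⟨h j (mem_range.1 hj).le, h (j + 1) (mem_range.1 hj)⟩

theorem sum_crossing_of_fst_eq_zero (h : ∀ j < N, l j 0 = 0) :
    ∑ j ∈ range N, crossing (l j) (l (j + 1)) = 0 :=
  sum_eq_zero fun j hj => by simp [crossing, h j (mem_range.1 hj)]

theorem sum_crossing_of_snd_eq {a : Fin 2} (h : ∀ j ≤ N, l j 1 = a) :
    ∑ j ∈ range N, crossing (l j) (l (j + 1)) = 0 :=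
  sum_eq_zero fun j hj => by
    simp [crossing, h j (mem_range.1 hj).le, h (j + 1) (mem_range.1 hj)]

end Walk

section Grid

open Finset

variable {A : Type*} [AddCommMonoid A] {vert horiz : ℕ → ℕ → A} {M N : ℕ}

theorem sum_vert_add_horiz_eq_of_square {i : ℕ}
    (square : ∀ j < N, vert i j + horiz i (j + 1) = horiz i j + vert (i + 1) j) :
    ∑ j ∈ range N, vert i j + horiz i N = horiz i 0 + ∑ j ∈ range N, vert (i + 1) j := by
  induction N with
  | zero => simp
  | succ N ih =>
    rw [sum_range_succ, sum_range_succ, add_assoc, square N N.lt_succ_self, ← add_assoc,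
      ih fun j hj => square j (hj.trans N.lt_succ_self), add_assoc]

theorem sum_vert_add_sum_horiz_eq_of_square
    (square : ∀ i < M, ∀ j < N, vert i j + horiz i (j + 1) = horiz i j + vert (i + 1) j) :
    ∑ j ∈ range N, vert 0 j + ∑ i ∈ range M, horiz i N =
      ∑ i ∈ range M, horiz i 0 + ∑ j ∈ range N, vert M j := by
  induction M with
  | zero => simp
  | succ M ih =>
    rw [sum_range_succ, sum_range_succ, ← add_assoc,
      ih fun i hi => square i (hi.trans M.lt_succ_self), add_assoc,
      sum_vert_add_horiz_eq_of_square (square M M.lt_succ_self), add_assoc]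

-- The pairs `v ≤ w ≤ v + 1` are the edges of the triangulation of the grid by the diagonals in
-- direction `(1, 1)`, together with the degenerate pairs `v = w`.
theorem sum_crossing_boundary_eq {n : Fin 2 → ℕ} {l : (Fin 2 → ℕ) → PieceSelection 2 2}
    (hdisj : ∀ v w, v ≤ w → w ≤ v + 1 → w ≤ n → ¬ DisjointSelections (l v) (l w)) :
    ∑ j ∈ range (n 1), crossing (l ![0, j]) (l ![0, j + 1]) +
        ∑ i ∈ range (n 0), crossing (l ![i, n 1]) (l ![i + 1, n 1]) =
      ∑ i ∈ range (n 0), crossing (l ![i, 0]) (l ![i + 1, 0]) +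
        ∑ j ∈ range (n 1), crossing (l ![n 0, j]) (l ![n 0, j + 1]) := by
  refine sum_vert_add_sum_horiz_eq_of_square
    (vert := fun i j => crossing (l ![i, j]) (l ![i, j + 1]))
    (horiz := fun i j => crossing (l ![i, j]) (l ![i + 1, j])) fun i hi j hj => ?_
  have edge {a b a' b' : ℕ} (ha : a ≤ a' ∧ a' ≤ a + 1 ∧ a' ≤ n 0)
      (hb : b ≤ b' ∧ b' ≤ b + 1 ∧ b' ≤ n 1) :
      ¬ DisjointSelections (l ![a, b]) (l ![a', b']) :=
    hdisj _ _ (by simpa [Pi.le_def, Fin.forall_fin_two] using ⟨ha.1, hb.1⟩)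
      (by simpa [Pi.le_def, Fin.forall_fin_two] using ⟨ha.2.1, hb.2.1⟩)
      (by simpa [Pi.le_def, Fin.forall_fin_two] using ⟨ha.2.2, hb.2.2⟩)
  trans crossing (l ![i, j]) (l ![i + 1, j + 1])
  · exact crossing_add_crossing (edge (by lia) (by lia)) (edge (by lia) (by lia))
      (edge (by lia) (by lia))
  · exact (crossing_add_crossing (edge (by lia) (by lia)) (edge (by lia) (by lia))
      (edge (by lia) (by lia))).symm

theorem exists_disjointSelections_of_boundary {n : Fin 2 → ℕ}
    {l : (Fin 2 → ℕ) → PieceSelection 2 2}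
    (lower : ∀ v ≤ n, ∀ i, v i = 0 → l v i = 1) (upper : ∀ v ≤ n, ∀ i, v i = n i → l v i = 0) :
    ∃ v w, v ≤ w ∧ w ≤ v + 1 ∧ w ≤ n ∧ DisjointSelections (l v) (l w) := by
  by_contra! hdisj
  have mem {i j : ℕ} (hi : i ≤ n 0) (hj : j ≤ n 1) : ![i, j] ≤ n := by
    simpa [Pi.le_def, Fin.forall_fin_two] using ⟨hi, hj⟩
  have left : ∑ j ∈ range (n 1), crossing (l ![0, j]) (l ![0, j + 1]) = 1 := by
    rw [sum_crossing_of_fst_eq_one (l := fun j => l ![0, j])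
        fun j hj => lower _ (mem (Nat.zero_le _) hj) 0 rfl,
      lower _ (mem (Nat.zero_le _) (Nat.zero_le _)) 1 rfl,
      upper _ (mem (Nat.zero_le _) le_rfl) 1 rfl]
    rfl
  have right : ∑ j ∈ range (n 1), crossing (l ![n 0, j]) (l ![n 0, j + 1]) = 0 :=
    sum_crossing_of_fst_eq_zero (l := fun j => l ![n 0, j])
      fun j hj => upper _ (mem le_rfl hj.le) 0 rfl
  have bottom : ∑ i ∈ range (n 0), crossing (l ![i, 0]) (l ![i + 1, 0]) = 0 :=
    sum_crossing_of_snd_eq (l := fun i => l ![i, 0])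
      fun i hi => lower _ (mem hi (Nat.zero_le _)) 1 rfl
  have top : ∑ i ∈ range (n 0), crossing (l ![i, n 1]) (l ![i + 1, n 1]) = 0 :=
    sum_crossing_of_snd_eq (l := fun i => l ![i, n 1])
      fun i hi => upper _ (mem hi le_rfl) 1 rfl
  have boundary := sum_crossing_boundary_eq hdisj
  rw [left, right, bottom, top] at boundary
  exact absurd boundary (by decide)

end Grid

/-- The colouring of the grid `ℕᵐ` with `m + 1` colours in which the vertices of each simplex of
the standard triangulation have different colours. -/
def gridColor {m : ℕ} (v : Fin m → ℕ) : Fin (m + 1) :=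
  Fin.ofNat (m + 1) (∑ i, v i)

theorem gridColor_ne {m : ℕ} {v w : Fin m → ℕ} (hvw : v < w) (hwv : w ≤ v + 1) :
    gridColor v ≠ gridColor w := by
  intro h
  have hmod : ∑ i, v i ≡ ∑ i, w i [MOD m + 1] := congrArg Fin.val h
  have hlt : ∑ i, v i < ∑ i, w i := Fintype.sum_strictMono hvw
  have hle : ∑ i, w i ≤ ∑ i, v i + m := by
    simpa [Finset.sum_add_distrib] using Finset.sum_le_sum fun i (_ : i ∈ Finset.univ) => hwv i
  have hdvd : m + 1 ∣ ∑ i, w i - ∑ i, v i := (Nat.modEq_iff_dvd' hlt.le).1 hmod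
  have := Nat.le_of_dvd (Nat.sub_pos_of_lt hlt) hdvd
  lia

/-- The point of the unit cube with coordinates `v i / N`, truncated at `1`. -/
noncomputable def gridPoint {ι : Type*} (N : ℕ) (v : ι → ℕ) : ι → unitInterval :=
  fun i => Set.projIcc 0 1 zero_le_one ((v i : ℝ) / N)

theorem dist_gridPoint_le {ι : Type*} [Fintype ι] (N : ℕ) {v w : ι → ℕ} (hvw : v ≤ w)
    (hwv : w ≤ v + 1) : dist (gridPoint N v) (gridPoint N w) ≤ 1 / N := by
  refine (dist_pi_le_iff (by positivity)).2 fun i => ?_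
  have hdist : dist (v i : ℝ) (w i) ≤ 1 := by
    have h₁ : (v i : ℝ) ≤ w i := by exact_mod_cast hvw i
    have h₂ : (w i : ℝ) ≤ v i + 1 := by exact_mod_cast hwv i
    rw [Real.dist_eq, abs_le]
    constructor <;> linarith
  calc dist (gridPoint N v i) (gridPoint N w i)
      ≤ dist ((v i : ℝ) / N) ((w i : ℝ) / N) := by
        simpa only [gridPoint, NNReal.coe_one, one_mul] using
          (LipschitzWith.projIcc (zero_le_one (α := ℝ))).dist_le_mul ((v i : ℝ) / N) (w i / N)
    _ = dist (v i : ℝ) (w i) / N := by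
        rw [Real.dist_eq, ← sub_div, abs_div, Nat.abs_cast, Real.dist_eq]
    _ ≤ 1 / N := by gcongr

instance (m k : ℕ) : FirstCountableTopology (Division m k) :=
  inferInstanceAs (FirstCountableTopology
    {x : Fin m → Fin k → ℝ // ∀ i, (∀ j, 0 ≤ x i j) ∧ ∑ j, x i j = 1})

theorem Division.exists_pos {m k : ℕ} (x : Division m k) (i : Fin m) : ∃ j, 0 < x.1 i j := by
  have hsum : ∑ _ : Fin k, (0 : ℝ) < ∑ j, x.1 i j := by simp [(x.2 i).2]
  simpa using Finset.exists_lt_of_sum_lt hsum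

/-- The division of `m` cakes into two pieces each in which the first pieces have the given
lengths. It parametrizes the divisions by the unit cube. -/
def Division.ofFirst {m : ℕ} (c : Fin m → unitInterval) : Division m 2 :=
  ⟨fun i => ![c i, 1 - c i], fun i => by
    simpa [Fin.forall_fin_two] using ⟨(c i).2.1, (c i).2.2⟩⟩

theorem Division.continuous_ofFirst {m : ℕ} : Continuous (ofFirst (m := m)) := by
  refine Continuous.subtype_mk (continuous_pi fun i => continuous_pi fun j => ?_) _
  fin_cases j
  · change Continuous fun c : Fin m → unitInterval => (c i : ℝ)
    fun_prop
  · change Continuous fun c : Fin m → unitInterval => 1 - (c i : ℝ)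
    fun_prop

theorem Division.ofFirst_gridPoint_zero {m N : ℕ} {v : Fin m → ℕ} {i : Fin m} (h : v i = 0) :
    (ofFirst (gridPoint N v)).1 i 0 = 0 := by
  simp [ofFirst, gridPoint, h]

theorem Division.ofFirst_gridPoint_one {m N : ℕ} (hN : N ≠ 0) {v : Fin m → ℕ} {i : Fin m}
    (h : v i = N) : (ofFirst (gridPoint N v)).1 i 1 = 0 := by
  simp [ofFirst, gridPoint, h, hN]

theorem IsOrderly.exists_prefers {m k : ℕ} {better : Preference m k} (h : IsOrderly better)
    (x : Division m k) : ∃ s, Prefers better x s := by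
  have : Std.Irrefl (better x) := ⟨(h x).1⟩
  have : IsTrans _ (better x) := ⟨(h x).2⟩
  choose s _ using x.exists_pos
  obtain ⟨t, -, ht⟩ := (Finite.wellFounded_of_trans_of_irrefl (better x)).has_min
    Set.univ ⟨s, trivial⟩
  exact ⟨t, fun u _ => ht u trivial⟩

theorem IsHungry.ne_zero_of_prefers {m k : ℕ} {better : Preference m k} (h : IsHungry better)
    {x : Division m k} {s : PieceSelection m k} (hs : Prefers better x s) (i : Fin m) :
    x.1 i (s i) ≠ 0 := by
  intro hzero
  obtain ⟨j, hj⟩ := x.exists_pos i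
  have hne : j ≠ s i := by
    rintro rfl
    exact hj.ne' hzero
  exact hs (Function.update s i j) (mt Function.update_eq_self_iff.1 hne) <|
    h x s _ i (fun _ hk => Function.update_of_ne hk _ _) hzero (by simpa using hj)

theorem HasClosedPreferenceSets.isClosed {m k : ℕ} {better : Preference m k}
    (h : HasClosedPreferenceSets better) (s : PieceSelection m k) :
    IsClosed {x | Prefers better x s} :=
  IsSeqClosed.isClosed fun u x hu hx => h s u x hx hu

theorem exists_diag_mem_of_isClosed {X : Type*} [PseudoMetricSpace X] [CompactSpace X]
    {K : Set (X × X)} (hK : IsClosed K) (h : ∀ ε > 0, ∃ z ∈ K, dist z.1 z.2 < ε) :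
    ∃ x, (x, x) ∈ K := by
  by_contra! hdiag
  have hcompl : Kᶜ ∈ uniformity X := by
    rw [← nhdsSet_diagonal_eq_uniformity]
    refine hK.isOpen_compl.mem_nhdsSet.2 ?_
    rintro ⟨x, y⟩ (rfl : x = y)
    exact hdiag x
  obtain ⟨ε, hε, hsub⟩ := Metric.mem_uniformity_dist.1 hcompl
  obtain ⟨z, hz, hdist⟩ := h ε hε
  exact hsub hdist hz

section ColoredCover

variable {P : Fin 3 → PieceSelection 2 2 → Set (Division 2 2)}

theorem exists_dist_lt_disjointSelections (cover : ∀ p x, ∃ s, x ∈ P p s)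
    (ne_zero : ∀ p s, ∀ x ∈ P p s, ∀ i, x.1 i (s i) ≠ 0) {ε : ℝ} (hε : 0 < ε) :
    ∃ c d : Fin 2 → unitInterval, dist c d < ε ∧ ∃ p q s t, (p ≠ q ∧ DisjointSelections s t) ∧
      Division.ofFirst c ∈ P p s ∧ Division.ofFirst d ∈ P q t := by
  obtain ⟨n, hn⟩ := exists_nat_one_div_lt hε
  let point (v : Fin 2 → ℕ) : Division 2 2 := Division.ofFirst (gridPoint (n + 1) v)
  choose l hl using fun v => cover (gridColor v) (point v)
  have lower (v : Fin 2 → ℕ) (i : Fin 2) (hv : v i = 0) : l v i = 1 :=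
    Fin.eq_one_of_ne_zero _ fun h =>
      ne_zero _ _ _ (hl v) i (by rw [h, Division.ofFirst_gridPoint_zero hv])
  have upper (v : Fin 2 → ℕ) (i : Fin 2) (hv : v i = n + 1) : l v i = 0 := by
    by_contra h
    exact ne_zero _ _ _ (hl v) i
      (by rw [Fin.eq_one_of_ne_zero _ h, Division.ofFirst_gridPoint_one n.succ_ne_zero hv])
  obtain ⟨v, w, hvw, hwv, -, hdisj⟩ := exists_disjointSelections_of_boundary
    (n := fun _ => n + 1) (fun v _ => lower v) (fun v _ => upper v)
  have hne : v ≠ w := by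
    rintro rfl
    exact hdisj 0 rfl
  have hdist : dist (gridPoint (n + 1) v) (gridPoint (n + 1) w) < ε :=
    (dist_gridPoint_le _ hvw hwv).trans_lt (by exact_mod_cast hn)
  exact ⟨_, _, hdist, _, _, l v, l w,
    ⟨gridColor_ne (hvw.lt_of_ne hne) hwv, hdisj⟩, hl v, hl w⟩

theorem theorem4_general (closed : ∀ p s, IsClosed (P p s)) (cover : ∀ p x, ∃ s, x ∈ P p s)
    (ne_zero : ∀ p s, ∀ x ∈ P p s, ∀ i, x.1 i (s i) ≠ 0) :
    ∃ (x : Division 2 2) (p q : Fin 3) (s t : PieceSelection 2 2),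
      p ≠ q ∧ DisjointSelections s t ∧ x ∈ P p s ∧ x ∈ P q t := by
  let K : Set ((Fin 2 → unitInterval) × (Fin 2 → unitInterval)) :=
    {z | ∃ p q s t, (p ≠ q ∧ DisjointSelections s t) ∧
      Division.ofFirst z.1 ∈ P p s ∧ Division.ofFirst z.2 ∈ P q t}
  have hK : IsClosed K := by
    simp only [K, Set.ofPred_exists]
    refine isClosed_iUnion_of_finite fun p => isClosed_iUnion_of_finite fun q =>
      isClosed_iUnion_of_finite fun s => isClosed_iUnion_of_finite fun t => ?_
    exact isClosed_const.inter <|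
      ((closed p s).preimage (Division.continuous_ofFirst.comp continuous_fst)).inter
        ((closed q t).preimage (Division.continuous_ofFirst.comp continuous_snd))
  obtain ⟨c, p, q, s, t, ⟨hpq, hst⟩, hs, ht⟩ := exists_diag_mem_of_isClosed hK fun ε hε => by
    obtain ⟨c, d, hdist, hcd⟩ := exists_dist_lt_disjointSelections cover ne_zero hε
    exact ⟨(c, d), hcd, hdist⟩
  exact ⟨Division.ofFirst c, p, q, s, t, hpq, hst, hs, ht⟩

end ColoredCover

theorem theorem4 (better : Fin 3 → Preference 2 2)
    (orderly : ∀ p, IsOrderly (better p))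
    (hungry : ∀ p, IsHungry (better p))
    (closed : ∀ p, HasClosedPreferenceSets (better p)) :
    ∃ (x : Division 2 2) (p q : Fin 3) (s t : PieceSelection 2 2),
      p ≠ q ∧ DisjointSelections s t ∧ Prefers (better p) x s ∧ Prefers (better q) x t :=
  theorem4_general (P := fun p s => {x | Prefers (better p) x s}) (fun p => (closed p).isClosed)
    (fun p => (orderly p).exists_prefers) (fun p _ _ hs => (hungry p).ne_zero_of_prefers hs)
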